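/- Let \(\mathcal{B}(q)=\sum_{n\ge 0}\frac{q^n(-q;q^2)_n}{(q;q^2)_{n+1}}=\sum_{n\ge 0}b(n)q^n\) be McIntosh's second order mock theta function, where \((a;q)_n=\prod_{j=0}^{n-1}(1-aq^j)\). Let \(p\) be an odd prime and let \(1\le \ell\le p-1\) be an integer such that \(\left(\frac{8\ell+1}{p}\right)=-1\), where \(\left(\frac{\cdot}{p}\right)\) is the Legendre symbol. Then for all integers \(n\ge 0\) and \(k\ge 0\), \[ b\left(4p^{2k+3}n+\frac{(8\ell+1)p^{2k+2}-1}{2}\right)\equiv 0\pmod 8. \] -/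

import Mathlib

open scoped PowerSeries

namespace MockTheta

/-- The finite `q`-Pochhammer symbol `(a; q)_n = ∏_{j=0}^{n-1} (1 - a q^j)`. -/
def qPoch {R : Type*} [CommRing R] (a q : R) (n : ℕ) : R :=
  ∏ j ∈ Finset.range n, (1 - a * q ^ j)

/-- The denominators `(q; q^2)_n` have constant term `1`, hence are invertible in `ℤ⟦q⟧`. -/
theorem constantCoeff_qPoch (n : ℕ) :
    PowerSeries.constantCoeff (qPoch (PowerSeries.X : ℤ⟦X⟧) (PowerSeries.X ^ 2) n) = 1 := by
  simp [qPoch, map_prod]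

/-- The `n`-th summand `q^n (-q; q^2)_n / (q; q^2)_{n+1}` of `𝓑(q)`, as a formal power series
in `q = X` with integer coefficients. -/
noncomputable def term (n : ℕ) : ℤ⟦X⟧ :=
  PowerSeries.X ^ n * qPoch (-PowerSeries.X) (PowerSeries.X ^ 2) n *
    PowerSeries.invOfUnit (qPoch PowerSeries.X (PowerSeries.X ^ 2) (n + 1)) 1

/-- The inverse used in `term` is the true inverse. -/
theorem term_mul (n : ℕ) :
    term n * qPoch PowerSeries.X (PowerSeries.X ^ 2) (n + 1) =
      PowerSeries.X ^ n * qPoch (-PowerSeries.X) (PowerSeries.X ^ 2) n := by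
  rw [term, mul_assoc, PowerSeries.invOfUnit_mul _ _ (by simp [constantCoeff_qPoch]), mul_one]

/-- `b N` is the coefficient of `q^N` in `𝓑(q) = ∑_{n ≥ 0} q^n (-q; q^2)_n / (q; q^2)_{n+1}`.
The `n`-th summand is divisible by `q^n`, so only the summands with `n ≤ N` contribute
(see `coeff_term_of_lt` and `hasSum_term`). -/
noncomputable def b (N : ℕ) : ℤ :=
  ∑ n ∈ Finset.range (N + 1), PowerSeries.coeff N (term n)

theorem coeff_term_of_lt {N n : ℕ} (h : N < n) : PowerSeries.coeff N (term n) = 0 := by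
  rw [term, mul_assoc, PowerSeries.coeff_X_pow_mul', if_neg (by omega)]

open scoped PowerSeries.WithPiTopology in
/-- The series defining `𝓑(q)` converges in `ℤ⟦q⟧` (coefficientwise), and
`𝓑(q) = ∑_{N ≥ 0} b(N) q^N`. -/
theorem hasSum_term : HasSum term (PowerSeries.mk b) := by
  rw [PowerSeries.WithPiTopology.hasSum_iff_hasSum_coeff]
  intro N
  rw [PowerSeries.coeff_mk, b]
  refine hasSum_sum_of_ne_finset_zero fun n hn => coeff_term_of_lt ?_
  simpa using hn

end MockTheta

/-! Reversing the sign of q turns the summands of 𝓑 into those of negative index, so (1 - q)(𝓑(q) +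
𝓑(-q)) is the bilateral series `bilateralSum` at k = 1. A contiguous relation k → k + 2 connects
this series to its limit as k → ∞. The chain from k = 0 has the same limit, and there the series is
one-sided and is summed by the q-binomial theorem. Hence 𝓑(q) + 𝓑(-q) is an infinite product
(`evenSum_mul`), and Gauss's theta identity rewrites it as 2 ψ(q^4) (-q^2;q^4)^2 / (q^2;q^4)^2,
where ψ(x) = ∑ x^(s(s+1)/2) (`qPoch_cube_mul`).

Modulo 8 the quotient is 1 + 4r, where r has no exponent divisible by 4 (`exists_qPoch_sq`). So
b(4m) is, modulo 8, the coefficient of x^m in ψ(x), which vanishes unless 8m + 1 is a square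
(`eight_dvd_b`). For the indices in question, 8m + 1 is p^(2k+2) times a number congruent to the
nonresidue 8l + 1 modulo p.

All infinite products and limits are replaced by congruences modulo powers of q. -/

namespace MockTheta

/-! ### Finite q-products and Shanks' identity -/

section QPoch

variable {R : Type*} [CommRing R]

theorem qPoch_zero (a q : R) : qPoch a q 0 = 1 := by simp [qPoch]

theorem qPoch_succ (a q : R) (n : ℕ) : qPoch a q (n + 1) = qPoch a q n * (1 - a * q ^ n) := by
  simp [qPoch, Finset.prod_range_succ]

theorem qPoch_succ' (a q : R) (n : ℕ) :
    qPoch a q (n + 1) = (1 - a) * qPoch (a * q) q n := by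
  simp [qPoch, Finset.prod_range_succ', pow_succ', mul_assoc, mul_comm]

theorem qPoch_add (a q : R) (m n : ℕ) :
    qPoch a q (m + n) = qPoch a q m * qPoch (a * q ^ m) q n := by
  simp [qPoch, Finset.prod_range_add, pow_add, mul_assoc]

theorem qPoch_mul_qPoch_neg (a q : R) (n : ℕ) :
    qPoch a q n * qPoch (-a) q n = qPoch (a ^ 2) (q ^ 2) n := by
  rw [qPoch, qPoch, qPoch, ← Finset.prod_mul_distrib]
  exact Finset.prod_congr rfl fun j _ => by ring

theorem qPoch_two_mul (a q : R) (n : ℕ) :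
    qPoch a q (2 * n) = qPoch a (q ^ 2) n * qPoch (a * q) (q ^ 2) n := by
  induction n with
  | zero => simp [qPoch_zero]
  | succ n ih =>
    rw [show 2 * (n + 1) = 2 * n + 1 + 1 by ring, qPoch_succ, qPoch_succ, ih, qPoch_succ,
      qPoch_succ]
    ring

theorem map_qPoch {S : Type*} [CommRing S] (f : R →+* S) (a q : R) (n : ℕ) :
    f (qPoch a q n) = qPoch (f a) (f q) n := by
  simp [qPoch, map_prod]

theorem qPoch_zero_left (q : R) (n : ℕ) : qPoch 0 q n = 1 := by simp [qPoch]

/-- Shanks' finite form of Gauss's identity for `∑ x ^ (s (s + 1) / 2)`. -/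
theorem shanks_identity (x : R) (n : ℕ) :
    ∑ s ∈ Finset.range n,
        (∏ i ∈ Finset.Ico s n, (1 - x ^ (2 * i + 2))) * qPoch x (x ^ 2) s * x ^ (s * (2 * n + 1)) =
      qPoch x (x ^ 2) n * ∑ s ∈ Finset.range (2 * n), x ^ (s * (s + 1) / 2) := by
  induction n with
  | zero => simp
  | succ n ih =>
    set w : ℕ → R := fun s =>
      (∏ i ∈ Finset.Ico s n, (1 - x ^ (2 * i + 2))) * qPoch x (x ^ 2) s * x ^ (s * (2 * n + 1))
      with hw
    -- Up to the factor 1 - x^(2n+1), passing from n to n + 1 changes each summand by a discrete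
    -- difference. The boundary value at s = n, together with the new last summand, yields the two
    -- new triangular powers.
    have hstep : ∀ s ∈ Finset.range n,
        (∏ i ∈ Finset.Ico s (n + 1), (1 - x ^ (2 * i + 2))) * qPoch x (x ^ 2) s *
            x ^ (s * (2 * (n + 1) + 1)) =
          (1 - x ^ (2 * n + 1)) * w s +
            (w (s + 1) * (1 - x ^ (2 * (s + 1))) - w s * (1 - x ^ (2 * s))) := by
      intro s hs
      have hs' : s < n := Finset.mem_range.mp hs
      rw [Finset.prod_Ico_succ_top hs'.le]
      simp only [hw]
      rw [Finset.prod_eq_prod_Ico_succ_bot hs', qPoch_succ]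
      ring
    have hT : 2 * n * (2 * n + 1) / 2 = n * (2 * n + 1) := by
      rw [mul_assoc, Nat.mul_div_cancel_left _ two_pos]
    have hT' : (2 * n + 1) * (2 * n + 1 + 1) / 2 = n * (2 * n + 1) + (2 * n + 1) := by
      rw [show (2 * n + 1) * (2 * n + 1 + 1) = 2 * (n * (2 * n + 1) + (2 * n + 1)) by ring,
        Nat.mul_div_cancel_left _ two_pos]
    rw [Finset.sum_range_succ, Finset.sum_congr rfl hstep, Finset.sum_add_distrib,
      ← Finset.mul_sum, Finset.sum_range_sub (fun s => w s * (1 - x ^ (2 * s))), ih,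
      show 2 * (n + 1) = 2 * n + 1 + 1 by ring, Finset.sum_range_succ, Finset.sum_range_succ,
      hT, hT', qPoch_succ]
    simp only [hw, Finset.Ico_self, Finset.prod_empty, Nat.Ico_succ_singleton,
      Finset.prod_singleton]
    ring

end QPoch

/-! ### Congruences modulo powers of q -/

open PowerSeries

/-- Truncation of power series modulo `X ^ M`, as a ring homomorphism. -/
noncomputable abbrev truncHom (M : ℕ) : ℤ⟦X⟧ →+* ℤ⟦X⟧ ⧸ Ideal.span {(X : ℤ⟦X⟧) ^ M} :=
  Ideal.Quotient.mk _

theorem truncHom_eq_iff {M : ℕ} {f g : ℤ⟦X⟧} : truncHom M f = truncHom M g ↔ X ^ M ∣ f - g := by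
  rw [Ideal.Quotient.mk_eq_mk_iff_sub_mem, Ideal.mem_span_singleton]

theorem truncHom_eq_zero {M : ℕ} {f : ℤ⟦X⟧} (h : X ^ M ∣ f) : truncHom M f = 0 := by
  rw [← map_zero (truncHom M), truncHom_eq_iff, sub_zero]
  exact h

theorem truncHom_X_pow {M n : ℕ} (h : M ≤ n) : truncHom M (X ^ n) = 0 :=
  truncHom_eq_zero (pow_dvd_pow _ h)

theorem coeff_eq_of_truncHom_eq {M n : ℕ} {f g : ℤ⟦X⟧} (h : truncHom M f = truncHom M g)
    (hn : n < M) : coeff n f = coeff n g := by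
  have := X_pow_dvd_iff.mp (truncHom_eq_iff.mp h) n hn
  rwa [map_sub, sub_eq_zero] at this

theorem mul_invOfUnit_one {f : ℤ⟦X⟧} (h : constantCoeff f = 1) : f * invOfUnit f 1 = 1 :=
  mul_invOfUnit _ _ (by simp [h])

theorem truncHom_mul_left_cancel {M : ℕ} {u f g : ℤ⟦X⟧} (hu : constantCoeff u = 1)
    (h : truncHom M u * truncHom M f = truncHom M u * truncHom M g) :
    truncHom M f = truncHom M g := by
  have hinv := congrArg (truncHom M) (mul_invOfUnit_one hu)
  rw [map_mul, map_one] at hinv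
  linear_combination (truncHom M (invOfUnit u 1)) * h + (truncHom M g - truncHom M f) * hinv

theorem constantCoeff_qPoch_of_left {a : ℤ⟦X⟧} (ha : constantCoeff a = 0) (q : ℤ⟦X⟧) (n : ℕ) :
    constantCoeff (qPoch a q n) = 1 := by
  simp [qPoch, map_prod, ha]

theorem truncHom_qPoch_eq_one {M : ℕ} {a : ℤ⟦X⟧} (ha : X ^ M ∣ a) (q : ℤ⟦X⟧) (n : ℕ) :
    truncHom M (qPoch a q n) = 1 := by
  rw [map_qPoch, truncHom_eq_zero ha, qPoch_zero_left]

/-! ### The bilateral series and its contiguous relation -/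

/-- The term of index `n` of the bilateral series
`∑ q ^ n (-q; q ^ 2)_n / (q ^ (k + 2); q ^ 2)_n`. -/
noncomputable def posTerm (k n : ℕ) : ℤ⟦X⟧ :=
  X ^ n * qPoch (-X) (X ^ 2) n * invOfUnit (qPoch (X ^ (k + 2)) (X ^ 2) n) 1

/-- The term of index `-m` of the bilateral series
`∑ q ^ n (-q; q ^ 2)_n / (q ^ (k + 2); q ^ 2)_n`. -/
noncomputable def negTerm (k m : ℕ) : ℤ⟦X⟧ :=
  (∏ i ∈ Finset.range m, (X ^ (2 * i) - X ^ k)) * invOfUnit (qPoch (-X) (X ^ 2) m) 1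

/-- The bilateral series `∑ q ^ n (-q; q ^ 2)_n / (q ^ (k + 2); q ^ 2)_n`, restricted to the
indices `-K ≤ n < K`. -/
noncomputable def bilateralSum (k K : ℕ) : ℤ⟦X⟧ :=
  ∑ n ∈ Finset.range K, posTerm k n + ∑ m ∈ Finset.range K, negTerm k (m + 1)

theorem constantCoeff_qPoch_X_pow (k n : ℕ) (q : ℤ⟦X⟧) :
    constantCoeff (qPoch (X ^ (k + 1)) q n) = 1 :=
  constantCoeff_qPoch_of_left (by simp) _ _

theorem constantCoeff_qPoch_neg_X (q : ℤ⟦X⟧) (n : ℕ) : constantCoeff (qPoch (-X) q n) = 1 :=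
  constantCoeff_qPoch_of_left (by simp) _ _

theorem ne_zero_of_constantCoeff {f : ℤ⟦X⟧} (h : constantCoeff f = 1) : f ≠ 0 := by
  rintro rfl
  simp at h

theorem posTerm_mul (k n : ℕ) :
    posTerm k n * qPoch (X ^ (k + 2)) (X ^ 2) n = X ^ n * qPoch (-X) (X ^ 2) n := by
  rw [posTerm, mul_assoc, invOfUnit_mul _ _ (by simp [constantCoeff_qPoch_X_pow]), mul_one]

theorem negTerm_mul (k m : ℕ) :
    negTerm k m * qPoch (-X) (X ^ 2) m = ∏ i ∈ Finset.range m, (X ^ (2 * i) - X ^ k) := by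
  rw [negTerm, mul_assoc, invOfUnit_mul _ _ (by simp [constantCoeff_qPoch_neg_X]), mul_one]

theorem posTerm_zero (k : ℕ) : posTerm k 0 = 1 := by
  simpa [qPoch_zero] using posTerm_mul k 0

theorem negTerm_zero (k : ℕ) : negTerm k 0 = 1 := by
  simpa [qPoch_zero] using negTerm_mul k 0

/-- Over a common denominator the left side has the factor (1 - q^(k+2+2n)) + q^(k+1)(1 + q^(2n+1)),
in which the dependence on n cancels. -/
theorem posTerm_contiguous (k n : ℕ) :
    (1 - X ^ (k + 2)) * (posTerm k n + X ^ k * posTerm k (n + 1)) =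
      (1 + X ^ (k + 1)) * posTerm (k + 2) n := by
  have h1 := posTerm_mul k n
  have h2 := posTerm_mul k (n + 1)
  have h3 := posTerm_mul (k + 2) n
  have h4 : qPoch (X ^ (k + 2)) (X ^ 2) (n + 1) =
      (1 - X ^ (k + 2)) * qPoch (X ^ (k + 2 + 2) : ℤ⟦X⟧) (X ^ 2) n := by
    rw [qPoch_succ']; ring_nf
  refine mul_right_cancel₀
    (ne_zero_of_constantCoeff (constantCoeff_qPoch_X_pow (k + 1) (n + 1) (X ^ 2))) ?_
  have h5 := qPoch_succ (X ^ (k + 2) : ℤ⟦X⟧) (X ^ 2) n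
  have h6 := qPoch_succ (-X : ℤ⟦X⟧) (X ^ 2) n
  rw [h6] at h2
  change _ * qPoch (X ^ (k + 2)) (X ^ 2) (n + 1) = _ * qPoch (X ^ (k + 2)) (X ^ 2) (n + 1)
  calc _ = (1 - X ^ (k + 2)) * (posTerm k n * qPoch (X ^ (k + 2)) (X ^ 2) (n + 1) +
        X ^ k * (posTerm k (n + 1) * qPoch (X ^ (k + 2)) (X ^ 2) (n + 1))) := by ring
    _ = (1 - X ^ (k + 2)) * (1 + X ^ (k + 1)) * (X ^ n * qPoch (-X) (X ^ 2) n) := by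
      rw [h2, h5, ← mul_assoc (posTerm k n), h1]; ring
    _ = (1 + X ^ (k + 1)) * (1 - X ^ (k + 2)) *
        (posTerm (k + 2) n * qPoch (X ^ (k + 2 + 2)) (X ^ 2) n) := by rw [h3]; ring
    _ = _ := by rw [h4]; ring

theorem prod_X_pow_sub (k m : ℕ) :
    ∏ i ∈ Finset.range (m + 1), ((X : ℤ⟦X⟧) ^ (2 * i) - X ^ (k + 2)) =
      (1 - X ^ (k + 2)) * X ^ (2 * m) * ∏ i ∈ Finset.range m, ((X : ℤ⟦X⟧) ^ (2 * i) - X ^ k) := by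
  have h : ∀ i ∈ Finset.range m, (X : ℤ⟦X⟧) ^ (2 * (i + 1)) - X ^ (k + 2) =
      X ^ 2 * (X ^ (2 * i) - X ^ k) := fun i _ => by ring
  rw [Finset.prod_range_succ', Finset.prod_congr rfl h, Finset.prod_mul_distrib, Finset.prod_const,
    Finset.card_range]
  ring

/-- The relation of `posTerm_contiguous` at index -(m + 1), whose successor is -m. -/
theorem negTerm_contiguous (k m : ℕ) :
    (1 - X ^ (k + 2)) * (negTerm k (m + 1) + X ^ k * negTerm k m) =
      (1 + X ^ (k + 1)) * negTerm (k + 2) (m + 1) := by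
  have h1 := negTerm_mul k m
  have h2 := negTerm_mul k (m + 1)
  have h3 := negTerm_mul (k + 2) (m + 1)
  rw [prod_X_pow_sub] at h3
  rw [Finset.prod_range_succ] at h2
  refine mul_right_cancel₀
    (ne_zero_of_constantCoeff (constantCoeff_qPoch_neg_X (X ^ 2) (m + 1))) ?_
  have h6 := qPoch_succ (-X : ℤ⟦X⟧) (X ^ 2) m
  rw [h6] at h2 h3 ⊢
  linear_combination (1 - X ^ (k + 2)) * h2 - (1 + X ^ (k + 1)) * h3 +
    (1 - X ^ (k + 2)) * X ^ k * (1 + X * (X ^ 2) ^ m) * h1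

/-- For k ≥ 1 every factor but i = 0 contributes a power of q, and q^k makes up for the missing one;
for k = 0 the factor i = 0 vanishes. -/
theorem X_pow_dvd_mul_negTerm (k m : ℕ) : X ^ m ∣ X ^ k * negTerm k m := by
  rcases m with _ | m
  · simp
  rw [negTerm, ← mul_assoc]
  refine Dvd.dvd.mul_right ?_ _
  rw [Finset.prod_range_succ']
  rcases k with _ | k
  · simp
  rw [mul_comm, mul_assoc, pow_succ]
  refine mul_dvd_mul ?_ (Dvd.dvd.mul_left (dvd_pow_self _ (by simp)) _)
  conv_lhs => rw [← Finset.card_range m, ← Finset.prod_const]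
  exact Finset.prod_dvd_prod_of_dvd _ _ fun i _ =>
    dvd_sub (dvd_pow_self _ (by simp)) (dvd_pow_self _ (by simp))

/-- Summing the termwise relations shifts the window by one index; the two end terms left over are
divisible by q^K. -/
theorem bilateralSum_contiguous (k K : ℕ) :
    truncHom K ((1 - X ^ (k + 2)) * (1 + X ^ k) * bilateralSum k K) =
      truncHom K ((1 + X ^ (k + 1)) * bilateralSum (k + 2) K) := by
  have hp : (1 - X ^ (k + 2)) * (∑ n ∈ Finset.range K, posTerm k n +
      X ^ k * ∑ n ∈ Finset.range K, posTerm k (n + 1)) =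
      (1 + X ^ (k + 1)) * ∑ n ∈ Finset.range K, posTerm (k + 2) n := by
    simp only [Finset.mul_sum, ← Finset.sum_add_distrib]
    exact Finset.sum_congr rfl fun n _ => by rw [← posTerm_contiguous]
  have hn : (1 - X ^ (k + 2)) * (∑ m ∈ Finset.range K, negTerm k (m + 1) +
      X ^ k * ∑ m ∈ Finset.range K, negTerm k m) =
      (1 + X ^ (k + 1)) * ∑ m ∈ Finset.range K, negTerm (k + 2) (m + 1) := by
    simp only [Finset.mul_sum, ← Finset.sum_add_distrib]
    exact Finset.sum_congr rfl fun n _ => by rw [← negTerm_contiguous]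
  have hps := (Finset.sum_range_succ (posTerm k) K).symm.trans
    (Finset.sum_range_succ' (posTerm k) K)
  have hns := (Finset.sum_range_succ (negTerm k) K).symm.trans
    (Finset.sum_range_succ' (negTerm k) K)
  rw [posTerm_zero] at hps
  rw [negTerm_zero] at hns
  rw [truncHom_eq_iff]
  have hd : X ^ K ∣ (1 - X ^ (k + 2)) * (X ^ k * negTerm k K - X ^ k * posTerm k K) :=
    Dvd.dvd.mul_left (dvd_sub (X_pow_dvd_mul_negTerm k K)
      (Dvd.dvd.mul_left (by rw [posTerm, mul_assoc]; exact dvd_mul_right _ _) _)) _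
  convert hd using 1
  rw [bilateralSum, bilateralSum]
  linear_combination hp + hn + (1 - X ^ (k + 2)) * X ^ k * hps - (1 - X ^ (k + 2)) * X ^ k * hns

theorem bilateralSum_eq_prod (k K N : ℕ) :
    truncHom K (qPoch (X ^ (k + 2)) (X ^ 2) N * qPoch (-X ^ k) (X ^ 2) N * bilateralSum k K) =
      truncHom K (qPoch (-X ^ (k + 1)) (X ^ 2) N * bilateralSum (k + 2 * N) K) := by
  induction N with
  | zero => simp [qPoch_zero]
  | succ N ih =>
    have h := bilateralSum_contiguous (k + 2 * N) K
    rw [show k + 2 * (N + 1) = k + 2 * N + 2 by ring]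
    simp only [qPoch_succ, map_mul] at ih h ⊢
    have e1 : (X : ℤ⟦X⟧) ^ (k + 2) * (X ^ 2) ^ N = X ^ (k + 2 * N + 2) := by ring
    have e2 : -(X : ℤ⟦X⟧) ^ k * (X ^ 2) ^ N = -X ^ (k + 2 * N) := by ring
    have e3 : -(X : ℤ⟦X⟧) ^ (k + 1) * (X ^ 2) ^ N = -X ^ (k + 2 * N + 1) := by ring
    rw [e1, e2, e3, sub_neg_eq_add, sub_neg_eq_add]
    linear_combination truncHom K (1 - X ^ (k + 2 * N + 2)) * truncHom K (1 + X ^ (k + 2 * N)) * ih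
      + truncHom K (qPoch (-X ^ (k + 1)) (X ^ 2) N) * h

/-- Everything involving q^k disappears modulo q^M, so odd and even k share one limit. -/
theorem truncHom_bilateralSum {M k : ℕ} (h : M ≤ k) (K : ℕ) :
    truncHom M (bilateralSum k K) = truncHom M (bilateralSum M K) := by
  have hpos : ∀ {k}, M ≤ k → ∀ n,
      truncHom M (posTerm k n) = truncHom M (X ^ n * qPoch (-X) (X ^ 2) n) := by
    intro k hk n
    rw [← posTerm_mul k n, map_mul,
      truncHom_qPoch_eq_one (pow_dvd_pow _ (by omega : M ≤ k + 2)), mul_one]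
  have hneg : ∀ {k}, M ≤ k → ∀ m, truncHom M (negTerm k m) =
      (∏ i ∈ Finset.range m, truncHom M (X ^ (2 * i))) *
        truncHom M (invOfUnit (qPoch (-X) (X ^ 2) m) 1) := by
    intro k hk m
    simp only [negTerm, map_mul, map_prod, map_sub, truncHom_X_pow hk, sub_zero]
  simp only [bilateralSum, map_add, map_sum, hpos h, hneg h, hpos le_rfl, hneg le_rfl]

/-! ### The q-binomial theorem -/

/-- The truncated `q`-binomial series `∑ (-q; q ^ 2)_n / (q ^ 2; q ^ 2)_n q ^ (n (2 k + 1))`. -/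
noncomputable def qBinomialSum (k K : ℕ) : ℤ⟦X⟧ :=
  ∑ n ∈ Finset.range K, X ^ (2 * k * n) * posTerm 0 n

theorem bilateralSum_zero (K : ℕ) : bilateralSum 0 K = qBinomialSum 0 K := by
  simp [bilateralSum, qBinomialSum, negTerm, Finset.prod_range_succ']

theorem posTerm_dvd (k n : ℕ) : X ^ n ∣ posTerm k n := by
  rw [posTerm, mul_assoc]
  exact dvd_mul_right _ _

theorem posTerm_zero_succ (n : ℕ) :
    posTerm 0 (n + 1) * (1 - X ^ (2 * n + 2)) = posTerm 0 n * (1 + X ^ (2 * n + 1)) * X := by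
  have h1 := posTerm_mul 0 n
  have h2 := posTerm_mul 0 (n + 1)
  rw [qPoch_succ, qPoch_succ] at h2
  refine mul_right_cancel₀ (ne_zero_of_constantCoeff (constantCoeff_qPoch_X_pow 1 n (X ^ 2))) ?_
  linear_combination h2 - (1 + X ^ (2 * n + 1)) * X * h1

/-- The functional equation (1 - z) f(z) = (1 + qz) f(q^2 z) at z = q^(2k+1); the difference of the
truncated sides telescopes. -/
theorem qBinomialSum_step (k K : ℕ) :
    truncHom K ((1 - X ^ (2 * k + 1)) * qBinomialSum k K) =
      truncHom K ((1 + X ^ (2 * k + 2)) * qBinomialSum (k + 1) K) := by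
  have h : (1 - X ^ (2 * k + 1)) * qBinomialSum k K -
      (1 + X ^ (2 * k + 2)) * qBinomialSum (k + 1) K =
      -((1 - X ^ (2 * K)) * (X ^ (2 * k * K) * posTerm 0 K)) := by
    have hs := Finset.sum_range_sub
      (fun n => -((1 - X ^ (2 * n)) * (X ^ (2 * k * n) * posTerm 0 n))) K
    simp only [mul_zero, pow_zero, sub_self, zero_mul, neg_zero, sub_zero] at hs
    rw [← hs, qBinomialSum, qBinomialSum, Finset.mul_sum, Finset.mul_sum,
      ← Finset.sum_sub_distrib]
    refine Finset.sum_congr rfl fun n _ => ?_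
    linear_combination X ^ (2 * k * (n + 1)) * posTerm_zero_succ n
  rw [truncHom_eq_iff, h]
  exact (Dvd.dvd.mul_left (Dvd.dvd.mul_left (posTerm_dvd 0 K) _) _).neg_right

theorem qBinomialSum_eq_prod (K N : ℕ) :
    truncHom K (qPoch X (X ^ 2) N * qBinomialSum 0 K) =
      truncHom K (qPoch (-X ^ 2) (X ^ 2) N * qBinomialSum N K) := by
  induction N with
  | zero => simp [qPoch_zero]
  | succ N ih =>
    have h := qBinomialSum_step N K
    simp only [qPoch_succ, map_mul] at ih h ⊢
    have e1 : (X : ℤ⟦X⟧) * (X ^ 2) ^ N = X ^ (2 * N + 1) := by ring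
    have e3 : -(X : ℤ⟦X⟧) ^ 2 * (X ^ 2) ^ N = -X ^ (2 * N + 2) := by ring
    rw [e1, e3, sub_neg_eq_add]
    linear_combination truncHom K (1 - X ^ (2 * N + 1)) * ih
      + truncHom K (qPoch (-X ^ 2) (X ^ 2) N) * h

theorem truncHom_qBinomialSum (N K : ℕ) :
    truncHom (2 * N) (qBinomialSum N (K + 1)) = 1 := by
  rw [qBinomialSum, Finset.sum_range_succ', map_add, truncHom_eq_zero, zero_add]
  · simp [posTerm_zero]
  · exact Finset.dvd_sum fun n _ => Dvd.dvd.mul_right (pow_dvd_pow _ (by nlinarith)) _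

/-! ### Product formula for the even part of 𝓑 -/

/-- The truncation of `𝓑(q) + 𝓑(-q)`. -/
noncomputable def evenSum (K : ℕ) : ℤ⟦X⟧ :=
  ∑ n ∈ Finset.range K, (term n + rescale (-1) (term n))

theorem coeff_evenSum {N K : ℕ} (hN : Even N) (hK : N < K) : coeff N (evenSum K) = 2 * b N := by
  have h : ∀ n, coeff N (term n + rescale (-1) (term n)) = 2 * coeff N (term n) := fun n => by
    rw [map_add, coeff_rescale, hN.neg_one_pow]; ring
  rw [evenSum, map_sum, Finset.sum_congr rfl fun n _ => h n, ← Finset.mul_sum, b]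
  congr 1
  refine (Finset.sum_subset (Finset.range_mono hK) fun n _ hn => coeff_term_of_lt ?_).symm
  simpa using hn

theorem rescale_neg_one_X : rescale (-1 : ℤ) X = -X := by
  ext n
  rw [coeff_rescale, map_neg, coeff_X]
  split_ifs with h <;> simp [h]

theorem one_sub_X_mul_evenSum (K : ℕ) : (1 - X) * evenSum K = bilateralSum 1 K := by
  rw [evenSum, bilateralSum, Finset.sum_add_distrib, mul_add, Finset.mul_sum, Finset.mul_sum]
  congr 1
  · refine Finset.sum_congr rfl fun n _ => ?_
    refine mul_right_cancel₀ (ne_zero_of_constantCoeff (constantCoeff_qPoch_X_pow 2 n (X ^ 2))) ?_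
    have h := term_mul n
    rw [qPoch_succ', ← pow_succ'] at h
    exact .trans (by ring_nf) (h.trans (posTerm_mul 1 n).symm)
  · refine Finset.sum_congr rfl fun n _ => ?_
    refine mul_right_cancel₀ (ne_zero_of_constantCoeff
      (constantCoeff_qPoch_neg_X (X ^ 2) (n + 1))) ?_
    have h := congrArg (rescale (-1 : ℤ)) (term_mul n)
    simp only [map_mul, map_qPoch, map_pow, map_neg, rescale_neg_one_X, neg_neg, neg_sq] at h
    rw [mul_assoc, h, negTerm_mul]
    have e : ∀ i ∈ Finset.range n, (X : ℤ⟦X⟧) ^ (2 * (i + 1)) - X ^ 1 =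
        -X * (1 - X * (X ^ 2) ^ i) := fun i _ => by ring
    rw [Finset.prod_range_succ', Finset.prod_congr rfl e, Finset.prod_mul_distrib,
      Finset.prod_const, Finset.card_range, qPoch]
    ring

/-- The product formula for `𝓑(q) + 𝓑(-q)`, modulo `q ^ (2 N)`. -/
theorem evenSum_mul (N : ℕ) :
    truncHom (2 * N) (evenSum (2 * N) * qPoch (X ^ 2) (X ^ 4) N ^ 2) =
      truncHom (2 * N) (2 * qPoch (-X ^ 2) (X ^ 2) N ^ 3 * qPoch (X ^ 2) (X ^ 2) N) := by
  rcases N with _ | N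
  · exact truncHom_eq_iff.mpr (by simp)
  generalize hM : N + 1 = M
  have hodd := bilateralSum_eq_prod 1 (2 * M) M
  have heven := bilateralSum_eq_prod 0 (2 * M) M
  have hbin := qBinomialSum_eq_prod (2 * M) M
  have hlim := truncHom_bilateralSum (by omega : 2 * M ≤ 1 + 2 * M) (2 * M)
  have hone : truncHom (2 * M) (qBinomialSum M (2 * M)) = 1 := by
    have := truncHom_qBinomialSum M (2 * M - 1)
    rwa [show 2 * M - 1 + 1 = 2 * M by omega] at this
  have ha : truncHom (2 * M) ((1 - X) * qPoch (X ^ 3) (X ^ 2) M) =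
      truncHom (2 * M) (qPoch X (X ^ 2) M) := by
    rw [show (X : ℤ⟦X⟧) ^ 3 = X * X ^ 2 by ring, ← qPoch_succ', qPoch_succ, ← pow_mul, map_mul,
      map_sub, map_mul _ X, truncHom_X_pow le_rfl]
    simp
  -- The leading factor of (-1;q^2)_M is 1 + 1 = 2, the source of the 2 in the product formula.
  have hd : truncHom (2 * M) (qPoch (-1) (X ^ 2) M) =
      truncHom (2 * M) (2 * qPoch (-X ^ 2) (X ^ 2) M) := by
    have h := congrArg (truncHom (2 * M))
      ((qPoch_succ (-1 : ℤ⟦X⟧) (X ^ 2) M).symm.trans (qPoch_succ' _ _ M))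
    rw [← pow_mul, map_mul, map_sub, map_mul _ (-1), truncHom_X_pow le_rfl, map_one, mul_zero,
      sub_zero, mul_one] at h
    rw [h]
    ring_nf
  have hg : qPoch (X ^ 2) (X ^ 4) M = qPoch (X : ℤ⟦X⟧) (X ^ 2) M * qPoch (-X) (X ^ 2) M := by
    rw [qPoch_mul_qPoch_neg]; ring_nf
  rw [← one_sub_X_mul_evenSum] at hodd
  rw [bilateralSum_zero] at heven
  rw [hg]
  simp only [pow_zero, zero_add, pow_one, Nat.reduceAdd, map_mul, map_pow, hlim, hone, hd,
    map_ofNat]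
    at hodd heven hbin ha ⊢
  linear_combination
    -(truncHom (2 * M) (evenSum (2 * M)) * truncHom (2 * M) (qPoch X (X ^ 2) M) *
        truncHom (2 * M) (qPoch (-X) (X ^ 2) M) ^ 2) * ha +
    truncHom (2 * M) (qPoch X (X ^ 2) M) * truncHom (2 * M) (qPoch (-X) (X ^ 2) M) * hodd -
    truncHom (2 * M) (qPoch X (X ^ 2) M) * truncHom (2 * M) (qPoch (-X ^ 2) (X ^ 2) M) * heven +
    2 * truncHom (2 * M) (qPoch (X ^ 2) (X ^ 2) M) *
      truncHom (2 * M) (qPoch (-X ^ 2) (X ^ 2) M) ^ 2 * hbin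

/-! ### Gauss's theta series -/

/-- Gauss's theta series `∑ q ^ (s (s + 1) / 2)` in the variable `q ^ 4`, truncated. -/
noncomputable def thetaSum (N : ℕ) : ℤ⟦X⟧ :=
  ∑ s ∈ Finset.range (2 * N), (X ^ 4) ^ (s * (s + 1) / 2)

theorem coeff_thetaSum_of_not_isSquare {N m : ℕ} (h : ¬ IsSquare (8 * m + 1)) :
    coeff (4 * m) (thetaSum N) = 0 := by
  rw [thetaSum, map_sum]
  refine Finset.sum_eq_zero fun s _ => ?_
  rw [← pow_mul, coeff_X_pow, if_neg]
  intro hs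
  refine h ⟨2 * s + 1, ?_⟩
  have h2 := Nat.div_mul_cancel (Nat.even_mul_succ_self s).two_dvd
  have : m = s * (s + 1) / 2 := by omega
  rw [← this] at h2
  linarith

theorem truncHom_qPoch_add {M : ℕ} {a q : ℤ⟦X⟧} {m : ℕ} (h : X ^ M ∣ a * q ^ m) (n : ℕ) :
    truncHom M (qPoch a q (m + n)) = truncHom M (qPoch a q m) := by
  rw [qPoch_add, map_mul, truncHom_qPoch_eq_one h, mul_one]

/-- Gauss's identity for the theta series, modulo `q ^ (2 N)`. -/
theorem thetaSum_mul (N : ℕ) :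
    truncHom (2 * N) (qPoch (X ^ 4) (X ^ 8) N * thetaSum N) =
      truncHom (2 * N) (qPoch (X ^ 8) (X ^ 8) N) := by
  rcases N with _ | N
  · exact truncHom_eq_iff.mpr (by simp)
  have h := shanks_identity ((X : ℤ⟦X⟧) ^ 4) (N + 1)
  rw [← pow_mul] at h
  rw [thetaSum, ← h]
  -- Only the summand s = 0 of Shanks' identity survives the truncation.
  rw [Finset.sum_range_succ', map_add, truncHom_eq_zero, zero_add]
  · simp only [qPoch_zero, mul_one, zero_mul, pow_zero]
    congr 1
    rw [qPoch, Finset.range_eq_Ico]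
    exact Finset.prod_congr rfl fun i _ => by ring
  · refine Finset.dvd_sum fun n _ => Dvd.dvd.mul_left ?_ _
    rw [← pow_mul]
    exact pow_dvd_pow _ (by nlinarith)

/-- In the limit, Euler's (q^4;q^8)(-q^4;q^4) = 1 turns Gauss's product for ψ(q^4) into
(q^4;q^4)(-q^4;q^4)^2; splitting (-q^2;q^2) by parity does the rest. -/
theorem qPoch_cube_mul (N : ℕ) :
    truncHom (2 * N) (qPoch (-X ^ 2) (X ^ 2) N ^ 3 * qPoch (X ^ 2) (X ^ 2) N) =
      truncHom (2 * N) (qPoch (-X ^ 2) (X ^ 4) N ^ 2 * thetaSum N) := by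
  have hψ := thetaSum_mul N
  have hd : truncHom (2 * N) (qPoch (-X ^ 2) (X ^ 4) N * qPoch (-X ^ 4) (X ^ 4) N) =
      truncHom (2 * N) (qPoch (-X ^ 2) (X ^ 2) N) := by
    have h1 := qPoch_two_mul (-(X : ℤ⟦X⟧) ^ 2) (X ^ 2) N
    have h2 := truncHom_qPoch_add (M := 2 * N) (a := -X ^ 2) (q := X ^ 2) (m := N)
      (by rw [← pow_mul, neg_mul]; exact (dvd_mul_left _ _).neg_right) N
    rw [← two_mul, h1] at h2
    rw [← h2]
    ring_nf
  have hde : qPoch (X ^ 2) (X ^ 2) N * qPoch (-X ^ 2) (X ^ 2) N = qPoch (X ^ 4 : ℤ⟦X⟧) (X ^ 4) N := by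
    rw [qPoch_mul_qPoch_neg]; ring_nf
  have hh : qPoch (X ^ 4) (X ^ 4) N * qPoch (-X ^ 4) (X ^ 4) N = qPoch (X ^ 8 : ℤ⟦X⟧) (X ^ 8) N := by
    rw [qPoch_mul_qPoch_neg]; ring_nf
  have ho : truncHom (2 * N) (qPoch (X ^ 4) (X ^ 8) N * qPoch (X ^ 8) (X ^ 8) N) =
      truncHom (2 * N) (qPoch (X ^ 4) (X ^ 4) N) := by
    have h1 := qPoch_two_mul ((X : ℤ⟦X⟧) ^ 4) (X ^ 4) N
    have h2 := truncHom_qPoch_add (M := 2 * N) (a := X ^ 4) (q := X ^ 4) (m := N)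
      (by rw [← pow_mul, ← pow_add]; exact pow_dvd_pow _ (by omega)) N
    rw [← two_mul, h1] at h2
    rw [← h2]
    ring_nf
  refine truncHom_mul_left_cancel (u := qPoch (X ^ 4) (X ^ 8) N * qPoch (X ^ 4) (X ^ 4) N)
    (by simp [constantCoeff_qPoch_X_pow]) ?_
  rw [← hh] at hψ ho
  have hde' := congrArg (truncHom (2 * N)) hde
  simp only [map_mul, map_pow] at hψ ho hde' hd ⊢
  set o := truncHom (2 * N) (qPoch (X ^ 4) (X ^ 8) N)
  set H := truncHom (2 * N) (qPoch (X ^ 4) (X ^ 4) N)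
  set D := truncHom (2 * N) (qPoch (-X ^ 2) (X ^ 2) N)
  set G := truncHom (2 * N) (qPoch (-X ^ 2) (X ^ 4) N)
  set P := truncHom (2 * N) (qPoch (-X ^ 4) (X ^ 4) N)
  linear_combination o * H * D ^ 2 * hde' - o * H ^ 2 * (G * P + D) * hd +
    H * G ^ 2 * P * ho - H * G ^ 2 * hψ

/-! ### Reduction modulo 8 -/

/-- `(1 + x) ^ 2 / (1 - x) ^ 2 ≡ 1 + 4 x / (1 - x ^ 2)` modulo `8`, with an odd correction. -/
theorem exists_sq_one_add (i : ℕ) : ∃ r : ℤ⟦X⟧, (∀ n, coeff (4 * n) r = 0) ∧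
    (8 : ℤ⟦X⟧) ∣ (1 + X ^ (4 * i + 2)) ^ 2 - (1 - X ^ (4 * i + 2)) ^ 2 * (1 + 4 * r) := by
  set x : ℤ⟦X⟧ := X ^ (4 * i + 2) with hx
  have hc : constantCoeff (1 + x) = 1 := by simp [hx]
  have hc' : constantCoeff (1 - x) = 1 := by simp [hx]
  set v := invOfUnit (1 + x) 1
  set w := invOfUnit (1 - x) 1
  have hv : (1 + x) * v = 1 := mul_invOfUnit_one hc
  have hw : (1 - x) * w = 1 := mul_invOfUnit_one hc'
  refine ⟨x * v * w, ?_, x ^ 2 * v, ?_⟩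
  -- With r = x/(1 - x^2), this is r = x + x^2 r: only odd powers of x occur, and their exponents
  -- are 2 modulo 4.
  · have hr : x * v * w = x + X ^ (8 * i + 4) * (x * v * w) := by
      have : (X : ℤ⟦X⟧) ^ (8 * i + 4) = x ^ 2 := by rw [hx]; ring
      rw [this]
      linear_combination x * (1 - x) * w * hv + x * hw
    intro n
    induction n using Nat.strong_induction_on with
    | _ n ih =>
      rw [hr, map_add, hx, coeff_X_pow, if_neg (by omega), zero_add, coeff_X_pow_mul']
      split_ifs with h
      · have := ih (n - (2 * i + 1)) (by omega)
        rwa [show 4 * (n - (2 * i + 1)) = 4 * n - (8 * i + 4) by omega] at this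
      · rfl
  · linear_combination (-4 * x * (1 - x) * v) * hw - 4 * x * hv

/-- The corrections of the factors add up, since (1 + 4r)(1 + 4s) ≡ 1 + 4(r + s) modulo 16. -/
theorem exists_qPoch_sq (N : ℕ) : ∃ r : ℤ⟦X⟧, (∀ n, coeff (4 * n) r = 0) ∧
    (8 : ℤ⟦X⟧) ∣ qPoch (-X ^ 2) (X ^ 4) N ^ 2 - qPoch (X ^ 2) (X ^ 4) N ^ 2 * (1 + 4 * r) := by
  induction N with
  | zero => exact ⟨0, by simp, by simp [qPoch_zero]⟩
  | succ N ih =>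
    obtain ⟨r, hr, u, hu⟩ := ih
    obtain ⟨s, hs, v, hv⟩ := exists_sq_one_add N
    refine ⟨r + s, fun n => by rw [map_add, hr, hs, add_zero],
      u * (1 + X ^ (4 * N + 2)) ^ 2 + qPoch (X ^ 2) (X ^ 4) N ^ 2 * (1 + 4 * r) * v +
        qPoch (X ^ 2) (X ^ 4) N ^ 2 * (1 - X ^ (4 * N + 2)) ^ 2 * (2 * r * s), ?_⟩
    rw [qPoch_succ, qPoch_succ]
    have e : (X : ℤ⟦X⟧) ^ 2 * (X ^ 4) ^ N = X ^ (4 * N + 2) := by ring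
    rw [neg_mul, e, sub_neg_eq_add]
    linear_combination (1 + X ^ (4 * N + 2)) ^ 2 * hu +
      qPoch (X ^ 2) (X ^ 4) N ^ 2 * (1 + 4 * r) * hv

theorem coeff_mul_thetaSum {r : ℤ⟦X⟧} (hr : ∀ n, coeff (4 * n) r = 0) (N m : ℕ) :
    coeff (4 * m) (r * thetaSum N) = 0 := by
  rw [thetaSum, Finset.mul_sum, map_sum]
  refine Finset.sum_eq_zero fun s _ => ?_
  rw [← pow_mul, coeff_mul_X_pow']
  split_ifs with h
  · rw [← Nat.mul_sub]
    exact hr _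
  · rfl

/-- `b (4 m)` is divisible by `8` unless `8 m + 1` is a square. -/
theorem eight_dvd_b {m : ℕ} (hm : ¬ IsSquare (8 * m + 1)) : (8 : ℤ) ∣ b (4 * m) := by
  -- Chosen so that 4m < 2N, which keeps the coefficient of q^(4m) within the truncation.
  set N := 2 * m + 1
  obtain ⟨r, hr, u, hu⟩ := exists_qPoch_sq N
  set g := qPoch (X ^ 2 : ℤ⟦X⟧) (X ^ 4) N
  have hg : constantCoeff (g ^ 2) = 1 := by
    rw [map_pow, constantCoeff_qPoch_X_pow, one_pow]
  have hginv := mul_invOfUnit_one hg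
  set gi := invOfUnit (g ^ 2) 1
  have key : truncHom (2 * N) (evenSum (2 * N)) = truncHom (2 * N)
      (2 * thetaSum N + 8 * (r * thetaSum N) + 16 * (gi * u * thetaSum N)) := by
    refine truncHom_mul_left_cancel hg ?_
    have h1 := evenSum_mul N
    have h2 := qPoch_cube_mul N
    have hu' := congrArg (truncHom (2 * N)) hu
    have hi' := congrArg (truncHom (2 * N)) hginv
    simp only [map_mul, map_add, map_sub, map_pow, map_one, map_ofNat] at h1 h2 hu' hi' ⊢
    linear_combination h1 + 2 * h2 + 2 * truncHom (2 * N) (thetaSum N) * hu' -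
      16 * truncHom (2 * N) u * truncHom (2 * N) (thetaSum N) * hi'
  have hc := coeff_eq_of_truncHom_eq (n := 4 * m) key (by omega)
  have e8 : (8 : ℤ⟦X⟧) = C 8 := rfl
  have e16 : (16 : ℤ⟦X⟧) = C 16 := rfl
  have e2 : (2 : ℤ⟦X⟧) = C 2 := rfl
  rw [coeff_evenSum ⟨2 * m, by ring⟩ (by omega), e8, e16, e2, map_add, map_add, coeff_C_mul,
    coeff_C_mul, coeff_C_mul, coeff_thetaSum_of_not_isSquare hm, coeff_mul_thetaSum hr] at hc
  omega

end MockTheta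

/-! ### Quadratic residues -/

theorem corollary2 (p : ℕ) [Fact p.Prime] (hp : Odd p) (l : ℕ) (hl : 1 ≤ l) (hlp : l ≤ p - 1)
    (hleg : legendreSym p (8 * (l : ℤ) + 1) = -1) (n k : ℕ) :
    MockTheta.b (4 * p ^ (2 * k + 3) * n + ((8 * l + 1) * p ^ (2 * k + 2) - 1) / 2) ≡ 0 [ZMOD 8] := by
  obtain ⟨c, hc⟩ : ∃ c, p ^ (2 * k + 2) = 8 * c + 1 := by
    have h1 : p ^ 2 % 8 = 1 := by
      obtain ⟨t, rfl⟩ := hp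
      obtain ⟨s, hs⟩ := Nat.even_mul_succ_self t
      have : (2 * t + 1) ^ 2 = 8 * s + 1 := by linarith
      omega
    have h2 : p ^ (2 * k + 2) % 8 = 1 := by
      rw [show 2 * k + 2 = 2 * (k + 1) by ring, pow_mul, Nat.pow_mod, h1, one_pow,
        Nat.one_mod]
    exact ⟨p ^ (2 * k + 2) / 8, by omega⟩
  set m := p ^ (2 * k + 3) * n + (8 * l * c + l + c) with hm
  have hidx : 4 * p ^ (2 * k + 3) * n + ((8 * l + 1) * p ^ (2 * k + 2) - 1) / 2 = 4 * m := by
    have : (8 * l + 1) * p ^ (2 * k + 2) - 1 = 2 * (4 * (8 * l * c + l + c)) := by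
      rw [hc, show (8 * l + 1) * (8 * c + 1) = 2 * (4 * (8 * l * c + l + c)) + 1 by ring,
        Nat.add_sub_cancel]
    rw [this, Nat.mul_div_cancel_left _ two_pos, hm]
    ring
  rw [hidx]
  refine Int.modEq_zero_iff_dvd.mpr (MockTheta.eight_dvd_b ?_)
  rintro ⟨t, ht⟩
  have hm' : 8 * m + 1 = (p ^ (k + 1)) ^ 2 * (8 * (p * n) + (8 * l + 1)) := by
    have e : (p ^ (k + 1)) ^ 2 = 8 * c + 1 := by rw [← hc]; ring
    have e' : p ^ (2 * k + 3) = p * (8 * c + 1) := by rw [← hc]; ring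
    rw [e, hm, e']
    ring
  -- Cancelling the square p^(2k+2) leaves 8pn + 8l + 1 = s^2, so 8l + 1 would be a square modulo p.
  have hdvd : p ^ (k + 1) ∣ t := by
    rw [← Nat.pow_dvd_pow_iff two_ne_zero, sq t, ← ht, hm']
    exact dvd_mul_right _ _
  obtain ⟨s, rfl⟩ := hdvd
  have hs : 8 * (p * n) + (8 * l + 1) = s ^ 2 := by
    have hpos : 0 < (p ^ (k + 1)) ^ 2 := by
      have := (Fact.out : p.Prime).pos
      positivity
    refine Nat.eq_of_mul_eq_mul_left hpos ?_
    rw [← hm', ht]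
    ring
  rw [legendreSym.eq_neg_one_iff] at hleg
  refine hleg ⟨(s : ZMod p), ?_⟩
  have := congrArg (Nat.cast : ℕ → ZMod p) hs
  push_cast at this ⊢
  rw [CharP.cast_eq_zero] at this
  linear_combination this
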